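/- For vectors $c_1,\dots,c_m\in\mathbb{R}^4$ let $[c_1,\dots,c_m]\subset\mathbb{RP}^3$ be the set of points represented by nonzero vectors $\sum_i t_ic_i$ with all $t_i\ge 0$. Let $V=[(0,0,0,1),(1,0,0,1),(1,1,0,1),(1,1,1,1)]$, that is, the set of points $(x:y:z:1)$ with $0\le z\le y\le x\le 1$, and let $$\mathsf{AB}=[(0,0,0,1),(1,0,0,1),(1,1,0,1)],\qquad \mathsf{AC}=[(0,0,0,1),(1,0,0,1),(1,1,1,1)]$$ be two of its faces. Let $$A=\begin{pmatrix}1&0&0&0\\1&0&-1&0\\0&1&-1&0\\0&0&-1&1\end{pmatrix},\qquad B=\begin{pmatrix}0&0&-1&1\\1&0&-1&0\\0&1&-1&0\\1&0&0&0\end{pmatrix},$$ and for $n\ge 1$ let $\mathbf{A}_n=BA^{3n-1}$, $\mathbf{B}_n=BA^{3n-2}$, $\mathbf{C}_n=BA^{3n-3}$. Define the pieces $$\mathbb{A}_n=\mathbf{A}_n^{-1}V\setminus[(1,0,0,n+1),(1,1,0,n+1),(1,1,1,n+1)],$$ $$\mathbb{B}_n=\mathbf{B}_n^{-1}V\setminus[(1,0,0,n),(1,1,0,n+1),(1,1,1,n+1)],$$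 $$\mathbb{C}_n=\mathbf{C}_n^{-1}V\setminus[(1,0,0,n),(1,1,0,n),(1,1,1,n+1)];$$ they partition $V\setminus\{\mathbf{0}\}$, where $\mathbf{0}=(0:0:0:1)$. The three-dimensional Gauss map $G:V\to V$ is given by $G(\mathbf{v})=\mathbf{X}_n\mathbf{v}$ for $\mathbf{v}\in\mathbb{X}_n$ ($\mathbb{X}\in\{\mathbb{A},\mathbb{B},\mathbb{C}\}$) and $G(\mathbf{0})=\mathbf{0}$. The itinerary of $\mathbf{v}\in V$ is the sequence of symbols of the pieces that contain $\mathbf{v},G(\mathbf{v}),G^2(\mathbf{v}),\dots$; it is infinite if the orbit never reaches $\mathbf{0}$, and otherwise it is finite and stops when the orbit reaches $\mathbf{0}$. Consider the directed graph with the two nodes $\mathsf{AB}$ and $\mathsf{AC}$ and, for every $n\ge 1$, the labelled edges $$\mathsf{AB}\xrightarrow{\mathbb{A}_n}\mathsf{AB},\qquad \mathsf{AC}\xrightarrow{\mathbb{A}_n}\mathsf{AC},\qquad \mathsf{AB}\xrightarrow{\mathbb{B}_n}\mathsf{AC},\qquad \mathsf{AC}\xrightarrow{\mathbb{C}_n}\mathsf{AB}.$$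 **Proposition.** For every point $\mathbf{v}\in V$: the itinerary of $\mathbf{v}$ is the sequence of labels along a (finite or infinite) path of this graph starting at the node $\mathsf{AB}$ if and only if $\mathbf{v}$ lies on the face $\mathsf{AB}$; and it is the sequence of labels along a path starting at the node $\mathsf{AC}$ if and only if $\mathbf{v}$ lies on the face $\mathsf{AC}$. -/

import Mathlib

open scoped LinearAlgebra.Projectivization MatrixGroups Pointwise

noncomputable section

namespace Gauss3

/-- Real projective 3-space, in homogeneous coordinates. -/
abbrev RP3 : Type := ℙ ℝ (Fin 4 → ℝ)

/-- The simplex in projective space whose vertices have the vectors `c i` as homogeneous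
coordinates: all points represented by a (nonzero) nonnegative combination of the `c i`. -/
def simplex {m : ℕ} (c : Fin m → Fin 4 → ℝ) : Set RP3 :=
  {p | ∃ (t : Fin m → ℝ) (h : ∑ i, t i • c i ≠ 0),
    (∀ i, 0 ≤ t i) ∧ p = Projectivization.mk ℝ (∑ i, t i • c i) h}

/-- The base tetrahedron, i.e. the points `[x : y : z : 1]` with `0 ≤ z ≤ y ≤ x ≤ 1`. -/
def V : Set RP3 :=
  simplex ![![0, 0, 0, 1], ![1, 0, 0, 1], ![1, 1, 0, 1], ![1, 1, 1, 1]]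

/-- The face `AB` of the base tetrahedron. -/
def faceAB : Set RP3 :=
  simplex ![![0, 0, 0, 1], ![1, 0, 0, 1], ![1, 1, 0, 1]]

/-- The face `AC` of the base tetrahedron. -/
def faceAC : Set RP3 :=
  simplex ![![0, 0, 0, 1], ![1, 0, 0, 1], ![1, 1, 1, 1]]

/-- The matrix `A` of the Mönkemeyer map. -/
def matA : GL (Fin 4) ℝ :=
  Matrix.GeneralLinearGroup.mkOfDetNeZero
    !![1, 0, 0, 0; 1, 0, -1, 0; 0, 1, -1, 0; 0, 0, -1, 1]
    (by simp [Matrix.det_succ_row_zero, Fin.sum_univ_succ, Fin.succAbove])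

/-- The matrix `B` of the Mönkemeyer map. -/
def matB : GL (Fin 4) ℝ :=
  Matrix.GeneralLinearGroup.mkOfDetNeZero
    !![0, 0, -1, 1; 1, 0, -1, 0; 0, 1, -1, 0; 1, 0, 0, 0]
    (by simp [Matrix.det_succ_row_zero, Fin.sum_univ_succ, Fin.succAbove])

/-- The alphabet `{A_n, B_n, C_n : n ≥ 1}`. -/
inductive Symb : Type
  | A (n : ℕ+)
  | B (n : ℕ+)
  | C (n : ℕ+)

/-- The matrices `A_n = B A^(3n-1)`, `B_n = B A^(3n-2)` and `C_n = B A^(3n-3)`. -/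
def Symb.mat : Symb → GL (Fin 4) ℝ
  | .A n => matB * matA ^ (3 * (n : ℕ) - 1)
  | .B n => matB * matA ^ (3 * (n : ℕ) - 2)
  | .C n => matB * matA ^ (3 * (n : ℕ) - 3)

/-- The face of the closed tetrahedron `s.mat⁻¹ • V` that does not belong to the piece
with symbol `s` (it is the one that `s.mat` maps to the frontal face `x = 1` of `V`). -/
def Symb.excludedFace : Symb → Set RP3
  | .A n => simplex ![![1, 0, 0, (n : ℝ) + 1], ![1, 1, 0, (n : ℝ) + 1], ![1, 1, 1, (n : ℝ) + 1]]
  | .B n => simplex ![![1, 0, 0, (n : ℝ)], ![1, 1, 0, (n : ℝ) + 1], ![1, 1, 1, (n : ℝ) + 1]]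
  | .C n => simplex ![![1, 0, 0, (n : ℝ)], ![1, 1, 0, (n : ℝ)], ![1, 1, 1, (n : ℝ) + 1]]

/-- The piece of the partition with symbol `s`. These pieces are pairwise disjoint and
cover all of `V` except the vertex `[0 : 0 : 0 : 1]`. -/
def Symb.piece (s : Symb) : Set RP3 := (s.mat⁻¹ • V) \ s.excludedFace

/-- The vertex `[0 : 0 : 0 : 1]` of `V`. -/
def origin : V :=
  ⟨Projectivization.mk ℝ ![0, 0, 0, 1] (fun h => by simpa using congrFun h 3),
    ![1, 0, 0, 0], by
      have e : ∑ i, (![1, 0, 0, 0] : Fin 4 → ℝ) i •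
          (![![0, 0, 0, 1], ![1, 0, 0, 1], ![1, 1, 0, 1], ![1, 1, 1, 1]] : Fin 4 → Fin 4 → ℝ) i
          = ![0, 0, 0, 1] := by simp [Fin.sum_univ_succ]
      refine ⟨fun h => ?_, fun i => ?_, ?_⟩
      · rw [e] at h
        simpa using congrFun h 3
      · fin_cases i <;> simp
      · congr 1
        exact e.symm⟩

open Classical in
/-- The symbol of the piece that contains `v`; there is none exactly when `v` is the origin. -/
def symbolAt (v : V) : Option Symb :=
  if h : ∃ s : Symb, (v : RP3) ∈ s.piece then some h.choose else none

theorem mem_piece_of_symbolAt {v : V} {s : Symb} (h : symbolAt v = some s) :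
    (v : RP3) ∈ s.piece := by
  unfold symbolAt at h
  split_ifs at h with h'
  cases h
  exact h'.choose_spec

/-- The three-dimensional Gauss map: multiplication by the matrix of the piece that contains
the point; the origin is mapped to itself. -/
def gaussMap (v : V) : V :=
  match h : symbolAt v with
  | some s => ⟨s.mat • (v : RP3), Set.mem_inv_smul_set_iff.mp (mem_piece_of_symbolAt h).1⟩
  | none => origin

/-- The itinerary of `v`: its `k`-th entry is the symbol of the piece that contains the `k`-th
iterate of `v`. The itinerary is finite (all further entries are `none`) if and only if the
orbit of `v` reaches the origin. -/
def itinerary (v : V) (k : ℕ) : Option Symb := symbolAt (gaussMap^[k] v)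

/-- The nodes of the graph. -/
inductive Node : Type
  | AB
  | AC

/-- The labelled edges of the graph. -/
inductive Edge : Node → Symb → Node → Prop
  | loopAB (n : ℕ+) : Edge .AB (.A n) .AB
  | loopAC (n : ℕ+) : Edge .AC (.A n) .AC
  | switchB (n : ℕ+) : Edge .AB (.B n) .AC
  | switchC (n : ℕ+) : Edge .AC (.C n) .AB

/-- The (finite or infinite) word `w` is the sequence of labels along a path of the graph
that starts at the node `s`. -/
def FollowsGraph (s : Node) (w : ℕ → Option Symb) : Prop :=
  ∃ q : ℕ → Node, q 0 = s ∧ ∀ k a, w k = some a → Edge (q k) a (q (k + 1))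

end Gauss3

end

/-!
A nonzero vector `(x, y, z, w)` with `0 ≤ z ≤ y ≤ x ≤ w` represents a point of `V`. In these
coordinates the piece `𝔸_n` is `n x + y ≤ w < (n + 1) x`, the piece `𝔹_n` is
`n x + z ≤ w < n x + y` and the piece `ℂ_n` is `n x ≤ w < n x + z`. The face `AB` is `z = 0` and
does not meet `ℂ_n`; the face `AC` is `y = z` and does not meet `𝔹_n`.

Along an edge of the graph the matrix of the label pulls the linear form that cuts out the face of
the target back to the one that cuts out the face of the source. Hence the orbit of a point of a
face traces a path. Conversely, along a path the value `d` of these forms on the lifted orbit is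
constant, and `0 ≤ d ≤ y`. Since `2 (w + x) - z` is nonnegative and drops by at least `y` in each
step, `d = 0` if the path is infinite. If it is finite, the orbit ends at the origin, where `d = 0`.
-/

namespace Gauss3

variable {p : RP3} {v : V} {u : Fin 4 → ℝ} {q q' : Node} {s : Symb}

theorem mk_mem_simplex_iff {m : ℕ} {c : Fin m → Fin 4 → ℝ} (f : (Fin 4 → ℝ) →ₗ[ℝ] ℝ)
    (hc : ∀ i, 0 < f (c i)) (hu : u ≠ 0) (hfu : 0 ≤ f u) :
    Projectivization.mk ℝ u hu ∈ simplex c ↔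
      ∃ t : Fin m → ℝ, (∀ i, 0 ≤ t i) ∧ ∑ i, t i • c i = u := by
  constructor
  · rintro ⟨t, hsum, ht, hmk⟩
    obtain ⟨a, rfl⟩ := (Projectivization.mk_eq_mk_iff' ℝ _ _ hu hsum).1 hmk
    have hf_pos : 0 < f (∑ i, t i • c i) := by
      obtain ⟨i, -, hi⟩ := Finset.exists_ne_zero_of_sum_ne_zero hsum
      simp only [map_sum, map_smul, smul_eq_mul]
      exact Finset.sum_pos' (fun j _ => mul_nonneg (ht j) (hc j).le)
        ⟨i, Finset.mem_univ i, mul_pos ((ht i).lt_of_ne' (left_ne_zero_of_smul hi)) (hc i)⟩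
    have ha : 0 ≤ a :=
      nonneg_of_mul_nonneg_left (by simpa only [map_smul, smul_eq_mul] using hfu) hf_pos
    exact ⟨a • t, fun i => mul_nonneg ha (ht i), by
      simp only [Pi.smul_apply, smul_assoc, Finset.smul_sum]⟩
  · rintro ⟨t, ht, rfl⟩
    exact ⟨t, hu, ht, rfl⟩

section Cone

/-- The cone in `ℝ⁴` whose image in projective space is the base tetrahedron `V`. -/
def cone : Set (Fin 4 → ℝ) := {u | 0 ≤ u 2 ∧ u 2 ≤ u 1 ∧ u 1 ≤ u 0 ∧ u 0 ≤ u 3}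

theorem nonneg_of_mem_cone (hu : u ∈ cone) (i : Fin 4) : 0 ≤ u i := by
  obtain ⟨hz, hzy, hyx, hxw⟩ := hu
  fin_cases i <;> simp only [Fin.zero_eta, Fin.mk_one, Fin.reduceFinMk] <;> linarith

theorem mk_mem_V_iff (hu : u ≠ 0) (hw : 0 ≤ u 3) : Projectivization.mk ℝ u hu ∈ V ↔ u ∈ cone := by
  rw [V, mk_mem_simplex_iff (.proj 3) (by simp [Fin.forall_fin_succ]) hu hw]
  constructor
  · rintro ⟨t, ht, rfl⟩
    simp [cone, Fin.sum_univ_succ, ht]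
  · rintro ⟨hz, hzy, hyx, hxw⟩
    refine ⟨![u 3 - u 0, u 0 - u 1, u 1 - u 2, u 2],
      by simp [Fin.forall_fin_succ, hz, hzy, hyx, hxw], ?_⟩
    ext i
    fin_cases i <;> simp [Fin.sum_univ_succ]

/-- The vector `u` of the cone consists of homogeneous coordinates of the point `p`. -/
def IsRep (p : RP3) (u : Fin 4 → ℝ) : Prop :=
  u ∈ cone ∧ ∃ hu : u ≠ 0, Projectivization.mk ℝ u hu = p

theorem exists_isRep (v : V) : ∃ u, IsRep v u := by
  obtain ⟨p, hp⟩ := v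
  induction p using Projectivization.ind with
  | h u hu =>
    rcases le_total 0 (u 3) with hw | hw
    · exact ⟨u, (mk_mem_V_iff hu hw).1 hp, hu, rfl⟩
    · have hmk : Projectivization.mk ℝ (-u) (neg_ne_zero.2 hu) = Projectivization.mk ℝ u hu :=
        (Projectivization.mk_eq_mk_iff' ℝ _ _ _ _).2 ⟨-1, neg_one_smul ℝ u⟩
      exact ⟨-u, (mk_mem_V_iff _ (by simpa using hw)).1 (hmk ▸ hp), neg_ne_zero.2 hu, hmk⟩

theorem isRep_origin : IsRep origin ![0, 0, 0, 1] :=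
  ⟨by simp [cone], _, rfl⟩

end Cone

section Face

theorem mem_faceAB_iff (h : IsRep p u) : p ∈ faceAB ↔ u 2 = 0 := by
  obtain ⟨hu, hu0, rfl⟩ := h
  have hy := nonneg_of_mem_cone hu 1
  have hw := nonneg_of_mem_cone hu 3
  obtain ⟨-, -, hyx, hxw⟩ := hu
  rw [faceAB, mk_mem_simplex_iff (.proj 3) (by simp [Fin.forall_fin_succ]) hu0 hw]
  constructor
  · rintro ⟨t, -, rfl⟩
    simp [Fin.sum_univ_succ]
  · intro heq
    refine ⟨![u 3 - u 0, u 0 - u 1, u 1], by simp [Fin.forall_fin_succ, hy, hyx, hxw], ?_⟩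
    ext i
    fin_cases i <;> simp [Fin.sum_univ_succ, heq]

theorem mem_faceAC_iff (h : IsRep p u) : p ∈ faceAC ↔ u 1 = u 2 := by
  obtain ⟨hu, hu0, rfl⟩ := h
  have hy := nonneg_of_mem_cone hu 1
  have hw := nonneg_of_mem_cone hu 3
  obtain ⟨-, -, hyx, hxw⟩ := hu
  rw [faceAC, mk_mem_simplex_iff (.proj 3) (by simp [Fin.forall_fin_succ]) hu0 hw]
  constructor
  · rintro ⟨t, -, rfl⟩
    simp [Fin.sum_univ_succ]
  · intro heq
    refine ⟨![u 3 - u 0, u 0 - u 1, u 1], by simp [Fin.forall_fin_succ, hy, hyx, hxw], ?_⟩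
    ext i
    fin_cases i <;> simp [Fin.sum_univ_succ, heq]

/-- The face of the base tetrahedron that corresponds to a node. -/
def Node.face : Node → Set RP3
  | .AB => faceAB
  | .AC => faceAC

/-- The linear form, nonnegative on the cone, that cuts out the face of a node. -/
def Node.form : Node → (Fin 4 → ℝ) → ℝ
  | .AB, u => u 2
  | .AC, u => u 1 - u 2

theorem Node.form_nonneg (q : Node) (hu : u ∈ cone) : 0 ≤ q.form u := by
  cases q with
  | AB => exact hu.1
  | AC => exact sub_nonneg.2 hu.2.1

theorem Node.form_le_apply_one (q : Node) (hu : u ∈ cone) : q.form u ≤ u 1 := by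
  cases q with
  | AB => exact hu.2.1
  | AC => exact sub_le_self _ hu.1

theorem mem_face_iff (h : IsRep p u) (q : Node) : p ∈ q.face ↔ q.form u = 0 := by
  cases q with
  | AB => exact mem_faceAB_iff h
  | AC => exact (mem_faceAC_iff h).trans sub_eq_zero.symm

theorem origin_mem_face (q : Node) : (origin : RP3) ∈ q.face := by
  rw [mem_face_iff isRep_origin]
  cases q <;> simp [Node.form]

end Face

section Matrices

theorem matA_smul (u : Fin 4 → ℝ) : matA • u = ![u 0, u 0 - u 2, u 1 - u 2, u 3 - u 2] := by
  change Matrix.mulVec !![1, 0, 0, 0; 1, 0, -1, 0; 0, 1, -1, 0; 0, 0, -1, 1] u = _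
  ext i
  fin_cases i <;> simp [Matrix.mulVec, dotProduct, Fin.sum_univ_succ] <;> ring

theorem matB_smul (u : Fin 4 → ℝ) : matB • u = ![u 3 - u 2, u 0 - u 2, u 1 - u 2, u 0] := by
  change Matrix.mulVec !![0, 0, -1, 1; 1, 0, -1, 0; 0, 1, -1, 0; 1, 0, 0, 0] u = _
  ext i
  fin_cases i <;> simp [Matrix.mulVec, dotProduct, Fin.sum_univ_succ] <;> ring

theorem matA_pow_three_mul_smul (k : ℕ) (u : Fin 4 → ℝ) :
    matA ^ (3 * k) • u = ![u 0, u 1, u 2, u 3 - k * u 0] := by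
  induction k with
  | zero =>
    ext i
    fin_cases i <;> simp
  | succ k ih =>
    rw [mul_add_one, add_comm, pow_add, mul_smul, ih, pow_three, mul_smul, mul_smul]
    simp only [matA_smul]
    ext i
    fin_cases i <;> simp
    ring

theorem mat_A_smul (n : ℕ+) (u : Fin 4 → ℝ) :
    (Symb.A n).mat • u = ![u 3 - n * u 0, u 1, u 2, u 0] := by
  have hn : 3 * (n : ℕ) - 1 = 2 + 3 * (n - 1) := by have := n.pos; lia
  rw [Symb.mat, hn, pow_add, pow_two, mul_smul, mul_smul, mul_smul, matA_pow_three_mul_smul,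
    Nat.cast_pred n.pos, matA_smul, matA_smul, matB_smul]
  ext i
  fin_cases i <;> simp
  ring

theorem mat_B_smul (n : ℕ+) (u : Fin 4 → ℝ) :
    (Symb.B n).mat • u = ![u 3 - (n - 1) * u 0 - u 1, u 0 - u 1 + u 2, u 0 - u 1, u 0] := by
  have hn : 3 * (n : ℕ) - 2 = 1 + 3 * (n - 1) := by have := n.pos; lia
  rw [Symb.mat, hn, pow_add, pow_one, mul_smul, mul_smul, matA_pow_three_mul_smul,
    Nat.cast_pred n.pos, matA_smul, matB_smul]
  ext i
  fin_cases i <;> simp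
  ring

theorem mat_C_smul (n : ℕ+) (u : Fin 4 → ℝ) :
    (Symb.C n).mat • u = ![u 3 - (n - 1) * u 0 - u 2, u 0 - u 2, u 1 - u 2, u 0] := by
  have hn : 3 * (n : ℕ) - 3 = 3 * (n - 1) := by lia
  rw [Symb.mat, hn, mul_smul, matA_pow_three_mul_smul, Nat.cast_pred n.pos, matB_smul]
  ext i
  fin_cases i <;> simp

theorem mat_smul_apply_three (s : Symb) (u : Fin 4 → ℝ) : (s.mat • u) 3 = u 0 := by
  cases s <;> simp [mat_A_smul, mat_B_smul, mat_C_smul]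

end Matrices

section Pieces

theorem mem_inv_smul_V_iff (h : IsRep p u) (s : Symb) : p ∈ s.mat⁻¹ • V ↔ s.mat • u ∈ cone := by
  obtain ⟨hu, hu0, rfl⟩ := h
  rw [Set.mem_inv_smul_set_iff, Projectivization.smul_mk]
  refine mk_mem_V_iff _ ?_
  rw [mat_smul_apply_three]
  exact nonneg_of_mem_cone hu 0

theorem mem_excludedFace_iff (h : IsRep p u) (s : Symb) :
    p ∈ s.excludedFace ↔ (s.mat • u) 0 = u 0 := by
  obtain ⟨hu, hu0, rfl⟩ := h
  have hw := nonneg_of_mem_cone hu 3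
  obtain ⟨hz, hzy, hyx, -⟩ := hu
  cases s with
  | A n | B n | C n =>
    have hn : (0 : ℝ) < n := Nat.cast_pos.2 n.pos
    rw [Symb.excludedFace, mk_mem_simplex_iff (.proj 3)
      (by simp [Fin.forall_fin_succ, n.pos, add_pos hn one_pos]) hu0 hw]
    simp only [mat_A_smul, mat_B_smul, mat_C_smul, Matrix.cons_val_zero]
    constructor
    · rintro ⟨t, -, rfl⟩
      simp [Fin.sum_univ_succ]
      ring
    · intro hx
      refine ⟨![u 0 - u 1, u 1 - u 2, u 2], by simp [Fin.forall_fin_succ, hz, hzy, hyx], ?_⟩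
      ext i
      fin_cases i <;> simp [Fin.sum_univ_succ]
      linarith

theorem mem_piece_iff (h : IsRep p u) (s : Symb) :
    p ∈ s.piece ↔ s.mat • u ∈ cone ∧ (s.mat • u) 0 ≠ u 0 := by
  rw [Symb.piece, Set.mem_sdiff, mem_inv_smul_V_iff h, mem_excludedFace_iff h]

theorem mem_piece_A_iff (h : IsRep p u) (n : ℕ+) :
    p ∈ (Symb.A n).piece ↔ n * u 0 + u 1 ≤ u 3 ∧ u 3 < (n + 1) * u 0 := by
  obtain ⟨hz, hzy, -, -⟩ := h.1
  simp only [mem_piece_iff h, mat_A_smul, cone, Set.mem_ofPred_eq, Matrix.cons_val]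
  grind

theorem mem_piece_B_iff (h : IsRep p u) (n : ℕ+) :
    p ∈ (Symb.B n).piece ↔ n * u 0 + u 2 ≤ u 3 ∧ u 3 < n * u 0 + u 1 := by
  obtain ⟨hz, -, hyx, -⟩ := h.1
  simp only [mem_piece_iff h, mat_B_smul, cone, Set.mem_ofPred_eq, Matrix.cons_val]
  grind

theorem mem_piece_C_iff (h : IsRep p u) (n : ℕ+) :
    p ∈ (Symb.C n).piece ↔ n * u 0 ≤ u 3 ∧ u 3 < n * u 0 + u 2 := by
  obtain ⟨-, hzy, hyx, -⟩ := h.1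
  simp only [mem_piece_iff h, mat_C_smul, cone, Set.mem_ofPred_eq, Matrix.cons_val]
  grind

theorem exists_mem_piece (h : IsRep p u) (hx : 0 < u 0) : ∃ s : Symb, p ∈ s.piece := by
  obtain ⟨-, -, -, hxw⟩ := h.1
  have hfloor : 0 < ⌊u 3 / u 0⌋₊ := Nat.floor_pos.2 ((one_le_div hx).2 hxw)
  obtain ⟨n, hn⟩ : ∃ n : ℕ+, (n : ℕ) = ⌊u 3 / u 0⌋₊ := ⟨⟨_, hfloor⟩, rfl⟩
  have hle : n * u 0 ≤ u 3 := by
    rw [← le_div_iff₀ hx, hn]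
    exact Nat.floor_le (div_nonneg (nonneg_of_mem_cone h.1 3) hx.le)
  have hlt : u 3 < (n + 1) * u 0 := by
    rw [← div_lt_iff₀ hx, hn]
    exact Nat.lt_floor_add_one _
  rcases le_or_gt (n * u 0 + u 1) (u 3) with hA | hA
  · exact ⟨.A n, (mem_piece_A_iff h n).2 ⟨hA, hlt⟩⟩
  rcases le_or_gt (n * u 0 + u 2) (u 3) with hB | hB
  · exact ⟨.B n, (mem_piece_B_iff h n).2 ⟨hB, hA⟩⟩
  · exact ⟨.C n, (mem_piece_C_iff h n).2 ⟨hle, hB⟩⟩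

theorem apply_zero_eq_zero_of_symbolAt_eq_none (h : IsRep v u) (hs : symbolAt v = none) :
    u 0 = 0 := by
  by_contra hx
  have hpiece := exists_mem_piece h ((nonneg_of_mem_cone h.1 0).lt_of_ne' hx)
  simp [symbolAt, hpiece] at hs

end Pieces

section GaussMap

theorem coe_gaussMap_of_symbolAt_eq_some (hs : symbolAt v = some s) :
    (gaussMap v : RP3) = s.mat • (v : RP3) := by
  unfold gaussMap
  split <;> simp_all

theorem gaussMap_of_symbolAt_eq_none (hs : symbolAt v = none) : gaussMap v = origin := by
  unfold gaussMap
  split <;> simp_all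

theorem isRep_gaussMap (h : IsRep v u) (hs : symbolAt v = some s) :
    IsRep (gaussMap v) (s.mat • u) := by
  refine ⟨((mem_piece_iff h s).1 (mem_piece_of_symbolAt hs)).1, ?_⟩
  obtain ⟨-, hu0, hmk⟩ := h
  exact ⟨(smul_ne_zero_iff_ne _).2 hu0, by
    rw [coe_gaussMap_of_symbolAt_eq_some hs, ← hmk, Projectivization.smul_mk]⟩

end GaussMap

section Edges

theorem Edge.form_mat_smul (he : Edge q s q') (u : Fin 4 → ℝ) :
    q'.form (s.mat • u) = q.form u := by
  cases he <;> simp [Node.form, mat_A_smul, mat_B_smul, mat_C_smul]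

theorem exists_edge_of_mem_face (h : IsRep p u) (hs : p ∈ s.piece) (hq : p ∈ q.face) :
    ∃ q', Edge q s q' := by
  cases s with
  | A n => cases q with
    | AB => exact ⟨_, .loopAB n⟩
    | AC => exact ⟨_, .loopAC n⟩
  | B n => cases q with
    | AB => exact ⟨_, .switchB n⟩
    | AC =>
      obtain ⟨hle, hlt⟩ := (mem_piece_B_iff h n).1 hs
      have hyz : u 1 = u 2 := (mem_faceAC_iff h).1 hq
      exact absurd (hyz ▸ hlt) hle.not_gt
  | C n => cases q with
    | AB =>
      obtain ⟨hle, hlt⟩ := (mem_piece_C_iff h n).1 hs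
      have hz : u 2 = 0 := (mem_faceAB_iff h).1 hq
      exact absurd (by simpa only [hz, add_zero] using hlt) hle.not_gt
    | AC => exact ⟨_, .switchC n⟩

theorem exists_edge_gaussMap_mem_face (v : V) (q : Node) (hv : (v : RP3) ∈ q.face) :
    ∃ q', (∀ s, symbolAt v = some s → Edge q s q') ∧ (gaussMap v : RP3) ∈ q'.face := by
  obtain ⟨u, hu⟩ := exists_isRep v
  cases hs : symbolAt v with
  | none =>
    rw [gaussMap_of_symbolAt_eq_none hs]
    exact ⟨q, nofun, origin_mem_face q⟩
  | some s =>
    obtain ⟨q', he⟩ := exists_edge_of_mem_face hu (mem_piece_of_symbolAt hs) hv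
    refine ⟨q', by rintro _ ⟨⟩; exact he, ?_⟩
    rw [mem_face_iff (isRep_gaussMap hu hs), he.form_mat_smul, ← mem_face_iff hu]
    exact hv

theorem followsGraph_of_mem_face (hv : (v : RP3) ∈ q.face) : FollowsGraph q (itinerary v) := by
  choose! next hedge hface using exists_edge_gaussMap_mem_face
  let path (k : ℕ) : Node := k.rec q fun k r => next (gaussMap^[k] v) r
  have hpath (k : ℕ) : (gaussMap^[k] v : RP3) ∈ (path k).face := by
    induction k with
    | zero => exact hv
    | succ k ih =>
      rw [Function.iterate_succ_apply']
      exact hface _ _ ih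
  exact ⟨path, rfl, fun k => hedge _ _ (hpath k)⟩

end Edges

section Potential

/-- A nonnegative function on the cone that every symbol decreases by at least the second
coordinate; the form of each node is at most that coordinate. -/
def potential (u : Fin 4 → ℝ) : ℝ := 2 * (u 3 + u 0) - u 2

theorem potential_nonneg (hu : u ∈ cone) : 0 ≤ potential u := by
  obtain ⟨hz, hzy, hyx, hxw⟩ := hu
  unfold potential
  linarith

theorem potential_mat_smul_add_le (s : Symb) (hu : u ∈ cone) :
    potential (s.mat • u) + u 1 ≤ potential u := by
  have hx := nonneg_of_mem_cone hu 0
  obtain ⟨-, hzy, hyx, -⟩ := hu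
  cases s with
  | A n | B n | C n =>
    have hn : 0 ≤ ((n : ℝ) - 1) * u 0 :=
      mul_nonneg (sub_nonneg.2 (Nat.one_le_cast.2 n.pos)) hx
    simp only [potential, mat_A_smul, mat_B_smul, mat_C_smul, Matrix.cons_val]
    linarith

theorem FollowsGraph.exists_edge_tail {w : ℕ → Option Symb} (h : FollowsGraph q w) :
    ∃ q', (∀ s, w 0 = some s → Edge q s q') ∧ FollowsGraph q' fun k => w (k + 1) := by
  obtain ⟨path, rfl, hpath⟩ := h
  exact ⟨path 1, hpath 0, fun k => path (k + 1), rfl, fun k => hpath (k + 1)⟩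

theorem nsmul_form_le_potential (h : FollowsGraph q (itinerary v)) (hu : IsRep v u) (k : ℕ) :
    k • q.form u ≤ potential u := by
  induction k generalizing v u q with
  | zero => simpa only [zero_smul] using potential_nonneg hu.1
  | succ k ih =>
    have hform_le := q.form_le_apply_one hu.1
    cases hs : symbolAt v with
    | none =>
      have hform : q.form u = 0 := by
        have hx := apply_zero_eq_zero_of_symbolAt_eq_none hu hs
        obtain ⟨-, -, hyx, -⟩ := hu.1
        exact (hform_le.trans (hyx.trans hx.le)).antisymm (q.form_nonneg hu.1)
      simpa only [hform, smul_zero] using potential_nonneg hu.1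
    | some s =>
      obtain ⟨q', hedge, htail⟩ := h.exists_edge_tail
      calc (k + 1) • q.form u
          = k • q'.form (s.mat • u) + q.form u := by
            rw [succ_nsmul, (hedge s hs).form_mat_smul]
        _ ≤ potential (s.mat • u) + u 1 := add_le_add (ih htail (isRep_gaussMap hu hs)) hform_le
        _ ≤ potential u := potential_mat_smul_add_le s hu.1

theorem mem_face_of_followsGraph (h : FollowsGraph q (itinerary v)) : (v : RP3) ∈ q.face := by
  obtain ⟨u, hu⟩ := exists_isRep v
  rw [mem_face_iff hu]
  by_contra hne
  obtain ⟨k, hk⟩ := exists_lt_nsmul ((q.form_nonneg hu.1).lt_of_ne' hne) (potential u)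
  exact (nsmul_form_le_potential h hu k).not_gt hk

end Potential

theorem followsGraph_itinerary_iff (v : V) (q : Node) :
    FollowsGraph q (itinerary v) ↔ (v : RP3) ∈ q.face :=
  ⟨mem_face_of_followsGraph, followsGraph_of_mem_face⟩

end Gauss3

theorem mainTheorem6 (v : Gauss3.V) :
    (Gauss3.FollowsGraph .AB (Gauss3.itinerary v) ↔ (v : Gauss3.RP3) ∈ Gauss3.faceAB) ∧
    (Gauss3.FollowsGraph .AC (Gauss3.itinerary v) ↔ (v : Gauss3.RP3) ∈ Gauss3.faceAC) :=
  ⟨Gauss3.followsGraph_itinerary_iff v .AB, Gauss3.followsGraph_itinerary_iff v .AC⟩
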